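/- Let $d\ge 1$, let $U=\{u_1,\dots,u_d\}$ be the vertex set of a clique, and let the set of colours be $[d+1]=\{1,\dots,d+1\}$. For a positive integer $t$, a list assignment $L:U\to 2^{[d+1]}$ is called $t$-feasible if $|L(u_i)|\ge t+1$ for every $i\le t$ and $|L(u_i)|=d+1$ for every $t<i\le d$. Let $\Omega^L_U$ be the set of $L$-colourings of the clique, i.e. of maps $\sigma:U\to[d+1]$ with $\sigma(u)\in L(u)$ for all $u$ and $\sigma(u)\ne\sigma(v)$ for all $u\neq v$. For $p_1,\dots,p_d>0$, the Glauber dynamics $\mathcal{L}^L_U$ with parameters $(p_1,\dots,p_d)$ is the continuous-time Markov chain on $\Omega^L_U$ that jumps from $\sigma$ to $\eta\ne\sigma$ at rate $p_i$ if $\sigma$ and $\eta$ differ only at $u_i$, and at rate $0$ if they differ at more than one vertex. Its spectral gap is the second smallest eigenvalue, counted with multiplicity, of $-\mathcal{L}^L_U$ (where $\mathcal{L}^L_U$ also denotes the generator matrix), and its relaxation time $\tau(\mathcal{L}^L_U)$ is the inverse of the spectral gap. For every positive integer $t$ there is a constant $C=C(t)>0$, depending only on $t$, such that for every $d\ge 1$,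 every $t$-feasible list assignment $L$ and all $p_1,\dots,p_d>0$, the chain $\mathcal{L}^L_U$ is ergodic (irreducible), its spectral gap is positive, and $$\tau(\mathcal{L}^L_U)\le C\left(\sum_{i=1}^{t}\frac{d}{p_i}+\sum_{i=t+1}^{d}\frac{1}{p_i}\right).$$ -/

import Mathlib

/-- The set of `L`-colourings of `G`: proper colourings `σ : V → [k]` with `σ v ∈ L v`. -/
abbrev ListColouring {V : Type*} {k : ℕ} (G : SimpleGraph V) (L : V → Finset (Fin k)) : Type _ :=
  {σ : V → Fin k // (∀ u v, G.Adj u v → σ u ≠ σ v) ∧ ∀ v, σ v ∈ L v}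

/-- The set of `L`-colourings of a finite graph is finite. -/
noncomputable instance ListColouring.instFintype {V : Type*} [Fintype V] {k : ℕ}
    (G : SimpleGraph V) (L : V → Finset (Fin k)) : Fintype (ListColouring G L) :=
  Fintype.ofFinite _

/-- Two colourings differ at the vertex `v` and at no other vertex. -/
def DifferOnlyAt {V : Type*} {k : ℕ} (σ η : V → Fin k) (v : V) : Prop :=
  σ v ≠ η v ∧ ∀ u, u ≠ v → σ u = η u

open Classical in
/-- The jump rate of the Glauber dynamics with parameters `p`: it is `p v` if `σ` and `η` differ
only at `v` (there is at most one such `v`, so the sum has at most one nonzero term), and `0` if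
there is no such vertex. -/
noncomputable def glauberRate {V : Type*} [Fintype V] {k : ℕ} (p : V → ℝ) (σ η : V → Fin k) : ℝ :=
  ∑ v, if DifferOnlyAt σ η v then p v else 0

open Classical in
/-- The generator matrix of the continuous-time Glauber dynamics on the `L`-colourings of `G` with
parameters `p`; the diagonal entries are such that every row adds up to `0`. -/
noncomputable def glauberGenerator {V : Type*} [Fintype V] {k : ℕ} (G : SimpleGraph V)
    (L : V → Finset (Fin k)) (p : V → ℝ) : Matrix (ListColouring G L) (ListColouring G L) ℝ :=
  Matrix.of fun σ η =>
    if σ = η then -∑ ξ ∈ Finset.univ.erase σ, glauberRate p σ.1 ξ.1 else glauberRate p σ.1 η.1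

/-- A continuous-time Markov chain on a finite state space with generator `Q` is ergodic if every
state can be reached from every other one through transitions of positive rate. -/
def IsErgodicGenerator {Ω : Type*} (Q : Matrix Ω Ω ℝ) : Prop :=
  ∀ x y, Relation.ReflTransGen (fun a b => a ≠ b ∧ 0 < Q a b) x y

open Classical in
/-- The spectral gap of a generator `Q`: the second smallest eigenvalue of `-Q`, counted with
multiplicity, i.e. the entry of index `1` in the increasing list of the roots of the characteristic
polynomial of `-Q`. It is meant for a symmetric `Q`, whose eigenvalues are all real. The default
value `0` is taken only if there is no second eigenvalue. -/
noncomputable def spectralGap {Ω : Type*} [Fintype Ω] (Q : Matrix Ω Ω ℝ) : ℝ :=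
  ((-Q).charpoly.roots.sort (· ≤ ·)).getD 1 0

/-- The relaxation time of a generator. -/
noncomputable def relaxationTime {Ω : Type*} [Fintype Ω] (Q : Matrix Ω Ω ℝ) : ℝ :=
  1 / spectralGap Q

/-- `t`-feasible list assignments of the clique `u_1, …, u_d` with `d + 1` colours; the vertex
`u_i` is the element `i - 1` of `Fin d`, so `i ≤ t` reads `(i - 1) < t`. -/
structure IsFeasible {d : ℕ} (t : ℕ) (L : Fin d → Finset (Fin (d + 1))) : Prop where
  constrained : ∀ i : Fin d, i.val < t → t + 1 ≤ (L i).card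
  free : ∀ i : Fin d, t ≤ i.val → (L i).card = d + 1

/-!
Add to the clique a hole that receives the colour left out by a colouring. Colourings become
bijections between positions and colours, and a Glauber move at `u_i` exchanges the values at `i`
and at the hole.

If no list is constrained, every permutation of the free positions is a product of transpositions
with the hole in which each of them occurs at most twice, so the Cauchy–Schwarz inequality gives a
Poincaré inequality with the sum of the inverse rates as its constant.

In general, induct on the number `t` of constrained positions. Fixing the colour `z` at a
constrained position `a` leaves lists of the same kind with `t - 1` constrained positions, so it
remains to compare the fibres of two colours `z` and `z'`. Exchanging these colours is allowed as
soon as `z'` sits at a free position `j`, and this holds for at least a fraction `1 / t` of the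
fibre of `z`: a constrained position can always give its colour away, because its list has more
colours than the constrained positions can hold. The exchange of `a` and `j` is a product of three
transpositions with the hole. The rate at `a` is charged once for every free position `j`: hence the
factor `d` in front of the inverse rates of the constrained positions.

The Poincaré inequality gives irreducibility, by testing it on the indicator of a communicating
class, and bounds the spectral gap from below, since two orthogonal eigenvectors span a nonzero
vector of mean zero.
-/

open Equiv

section StarTranspositions

variable {ι : Type*} [DecidableEq ι]

theorem le_swap_add_swap_mul (c : GroupSeminorm (Perm ι)) (g : Perm ι) (j h : ι) :
    c g ≤ c (swap j h) + c (swap j h * g) := by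
  simpa only [swap_mul_self_mul] using map_mul_le_add c (swap j h) (swap j h * g)

theorem add_swap_le_of_erase (c : GroupSeminorm (Perm ι)) {g : Perm ι} {h k : ι} {J : Finset ι}
    (hk : k ∈ J) (hgh : g h ≠ h)
    (hle : c (swap k h * g) + c (swap ((swap k h * g) h) h) ≤
      2 * ∑ j ∈ J.erase k, c (swap j h)) :
    c g + c (swap (g h) h) ≤ 2 * ∑ j ∈ J, c (swap j h) := by
  have hcancel := le_swap_add_swap_mul c g k h
  rw [← Finset.add_sum_erase _ _ hk]
  by_cases hghk : g h = k
  · rw [hghk]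
    linarith [apply_nonneg c (swap ((swap k h * g) h) h)]
  · rw [Perm.mul_apply, swap_apply_of_ne_of_ne hghk hgh] at hle
    linarith [apply_nonneg c (swap k h)]

variable [Fintype ι]

theorem support_swap_mul_subset_insert_erase {g : Perm ι} {h k : ι} {J : Finset ι}
    (hg : g.support ⊆ insert h J) (hgk : g k = h) :
    (swap k h * g).support ⊆ insert h (J.erase k) := by
  intro x hx
  rw [← hgk] at hx
  have hx' := Perm.mem_support_swap_mul_imp_mem_support_ne hx
  have := hg hx'.1
  grind

theorem support_swap_mul_subset_insert {g : Perm ι} {h j : ι} {J : Finset ι}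
    (hg : g.support ⊆ insert h J) (hj : j ∈ J) : (swap j h * g).support ⊆ insert h J := by
  intro x hx
  by_contra hxJ
  obtain ⟨hxh, hxJ⟩ : x ≠ h ∧ x ∉ J := by simpa using hxJ
  have hgx : g x = x := Perm.notMem_support.1 fun hx => by simpa [hxh, hxJ] using hg hx
  refine Perm.mem_support.1 hx ?_
  rw [Perm.mul_apply, hgx, swap_apply_of_ne_of_ne (ne_of_mem_of_not_mem hj hxJ).symm hxh]

/-- Transpositions with `h` are removed from `g` one by one: `swap (g⁻¹ h) h * g` has one moved
point less. Only when a cycle avoids `h` must it first be joined to `h`, which uses one of its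
points a second time; the extra term on the left pays for that. -/
theorem add_swap_le_two_mul_sum_swap (c : GroupSeminorm (Perm ι)) {h : ι} {J : Finset ι}
    {g : Perm ι} (hg : g.support ⊆ insert h J) :
    c g + c (swap (g h) h) ≤ 2 * ∑ j ∈ J, c (swap j h) := by
  induction J using Finset.strongInduction generalizing g with
  | H J ih =>
    have moved {g : Perm ι} (hg : g.support ⊆ insert h J) (hgh : g h ≠ h) :
        c g + c (swap (g h) h) ≤ 2 * ∑ j ∈ J, c (swap j h) := by
      obtain ⟨k, hgk⟩ := g.surjective h
      have hkh : k ≠ h := fun e => hgh (e ▸ hgk)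
      have hk : k ∈ J := Finset.mem_of_mem_insert_of_ne
        (hg (Perm.mem_support.2 (hgk.trans_ne hkh.symm))) hkh
      exact add_swap_le_of_erase c hk hgh
        (ih _ (Finset.erase_ssubset hk) (support_swap_mul_subset_insert_erase hg hgk))
    by_cases hgh : g h = h
    · rw [hgh, swap_self, ← Perm.one_def, map_one_eq_zero, add_zero]
      obtain rfl | hg1 := eq_or_ne g 1
      · rw [map_one_eq_zero]
        positivity
      obtain ⟨j, hj⟩ : ∃ j, g j ≠ j := not_forall.1 fun h => hg1 (Perm.ext h)
      have hjh : j ≠ h := fun e => hj (e ▸ hgh)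
      have hjJ : j ∈ J := Finset.mem_of_mem_insert_of_ne (hg (Perm.mem_support.2 hj)) hjh
      have hval : (swap j h * g) h = j := by rw [Perm.mul_apply, hgh, swap_apply_right]
      have hmoved := moved (support_swap_mul_subset_insert hg hjJ) (hval.trans_ne hjh)
      rw [hval] at hmoved
      linarith [le_swap_add_swap_mul c g j h]
    · exact moved hg hgh

end StarTranspositions

section DirichletForm

theorem sq_sub_le_three_mul (a b c d : ℝ) :
    (a - d) ^ 2 ≤ 3 * ((a - b) ^ 2 + (b - c) ^ 2 + (c - d) ^ 2) := by
  nlinarith [sq_nonneg ((a - b) - (b - c)), sq_nonneg ((b - c) - (c - d)),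
    sq_nonneg ((a - b) - (c - d))]

theorem sum_trans_of_mem_iff {ι κ : Type*} {X Y : Finset (ι ≃ κ)} {g : Perm ι}
    (hg : ∀ σ, g.trans σ ∈ Y ↔ σ ∈ X) (F : (ι ≃ κ) → ℝ) :
    ∑ σ ∈ X, F (g.trans σ) = ∑ σ ∈ Y, F σ :=
  Finset.sum_equiv (g.symm.equivCongr (Equiv.refl κ)) (fun σ => (hg σ).symm) fun _ _ => rfl

/-- The Dirichlet form of the moves `σ ↦ g.trans σ`, which permute the positions of a bijection `σ`
by `g`, as far as they stay inside `X`. -/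
def dirichletForm {ι κ : Type*} [DecidableEq (ι ≃ κ)] (X : Finset (ι ≃ κ)) (f : (ι ≃ κ) → ℝ)
    (g : Perm ι) : ℝ :=
  ∑ σ ∈ X with g.trans σ ∈ X, (f σ - f (g.trans σ)) ^ 2

section Elementary

variable {ι κ : Type*} [DecidableEq (ι ≃ κ)]

theorem dirichletForm_nonneg (X : Finset (ι ≃ κ)) (f : (ι ≃ κ) → ℝ) (g : Perm ι) :
    0 ≤ dirichletForm X f g :=
  Finset.sum_nonneg fun _ _ => sq_nonneg _

theorem dirichletForm_one (X : Finset (ι ≃ κ)) (f : (ι ≃ κ) → ℝ) : dirichletForm X f 1 = 0 :=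
  Finset.sum_eq_zero fun σ _ => by simp [Perm.one_def]

theorem dirichletForm_eq_sum_of_forall_mem {X : Finset (ι ≃ κ)} {g : Perm ι}
    (hg : ∀ σ ∈ X, g.trans σ ∈ X) (f : (ι ≃ κ) → ℝ) :
    dirichletForm X f g = ∑ σ ∈ X, (f σ - f (g.trans σ)) ^ 2 := by
  rw [dirichletForm, Finset.filter_true_of_mem hg]

theorem sum_dirichletForm_filter_le [DecidableEq κ] (X : Finset (ι ≃ κ)) (f : (ι ≃ κ) → ℝ)
    (g : Perm ι) (a : ι) (Z : Finset κ) :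
    ∑ z ∈ Z, dirichletForm {σ ∈ X | σ a = z} f g ≤ dirichletForm X f g := by
  calc ∑ z ∈ Z, dirichletForm {σ ∈ X | σ a = z} f g
      ≤ ∑ z ∈ Z, ∑ σ ∈ X with g.trans σ ∈ X ∧ σ a = z, (f σ - f (g.trans σ)) ^ 2 := by
        refine Finset.sum_le_sum fun z _ => Finset.sum_le_sum_of_subset_of_nonneg ?_
          fun _ _ _ => sq_nonneg _
        grind
    _ ≤ dirichletForm X f g := by
        simp only [← Finset.filter_filter]
        exact Finset.sum_fiberwise_le_sum_of_sum_fiber_nonneg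
          fun _ _ => Finset.sum_nonneg fun _ _ => sq_nonneg _

theorem dirichletForm_swap_le [DecidableEq ι] {X : Finset (ι ≃ κ)} {a h j : ι} (hah : a ≠ h)
    (haj : a ≠ j) (hX : ∀ σ, (swap j h).trans σ ∈ X ↔ σ ∈ X) (f : (ι ≃ κ) → ℝ) :
    dirichletForm X f (swap a j) ≤
      3 * (2 * dirichletForm X f (swap j h) + dirichletForm X f (swap a h)) := by
  set Y := {σ ∈ X | (swap a j).trans σ ∈ X} with hY
  have hconj (σ : ι ≃ κ) : (swap j h).trans ((swap a j).trans σ) =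
      (swap a h).trans ((swap j h).trans σ) := by
    have hperm : swap a j * swap j h = swap j h * swap a h := by
      rw [swap_comm a j, ← swap_mul_swap_mul_swap hah haj, swap_comm h j, mul_swap_mul_self]
    exact congrArg (Equiv.trans · σ) hperm
  have hfirst : ∑ σ ∈ Y, (f σ - f ((swap j h).trans σ)) ^ 2 ≤ dirichletForm X f (swap j h) := by
    rw [dirichletForm_eq_sum_of_forall_mem fun σ hσ => (hX σ).2 hσ]
    exact Finset.sum_le_sum_of_subset_of_nonneg (Finset.filter_subset _ _)
      fun _ _ _ => sq_nonneg _
  have hmiddle : ∑ σ ∈ Y, (f ((swap j h).trans σ) - f ((swap a h).trans ((swap j h).trans σ))) ^ 2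
      = dirichletForm X f (swap a h) :=
    sum_trans_of_mem_iff (fun σ => by simp only [hY, Finset.mem_filter, ← hconj, hX])
      fun σ => (f σ - f ((swap a h).trans σ)) ^ 2
  have hlast : ∑ σ ∈ Y, (f ((swap a j).trans σ) - f ((swap j h).trans ((swap a j).trans σ))) ^ 2
      = ∑ σ ∈ Y, (f σ - f ((swap j h).trans σ)) ^ 2 :=
    sum_trans_of_mem_iff
      (fun σ => by simp [hY, ← Equiv.trans_assoc, and_comm])
      fun σ => (f σ - f ((swap j h).trans σ)) ^ 2
  calc dirichletForm X f (swap a j)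
      ≤ ∑ σ ∈ Y, 3 * ((f σ - f ((swap j h).trans σ)) ^ 2 +
          (f ((swap j h).trans σ) - f ((swap a h).trans ((swap j h).trans σ))) ^ 2 +
          (f ((swap a j).trans σ) - f ((swap j h).trans ((swap a j).trans σ))) ^ 2) := by
        refine Finset.sum_le_sum fun σ _ => (sq_sub_le_three_mul _
          (f ((swap j h).trans σ)) (f ((swap a h).trans ((swap j h).trans σ))) _).trans_eq ?_
        rw [← hconj, sub_sq_comm (f ((swap a j).trans σ))]
    _ ≤ _ := by
        rw [← Finset.mul_sum, Finset.sum_add_distrib, Finset.sum_add_distrib, hmiddle, hlast]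
        linarith

end Elementary

variable {ι κ : Type*} [Fintype ι] [DecidableEq ι] [DecidableEq κ]

section Displacement

variable [Fintype κ]

theorem dist_toLp_trans (g : Perm ι) (u v : (ι ≃ κ) → ℝ) :
    dist (WithLp.toLp 2 fun σ => u (g.trans σ)) (WithLp.toLp 2 fun σ => v (g.trans σ)) =
      dist (WithLp.toLp 2 u) (WithLp.toLp 2 v) := by
  simp only [EuclideanSpace.dist_eq]
  exact congrArg Real.sqrt <|
    Equiv.sum_comp (g.symm.equivCongr (Equiv.refl κ)) fun σ => dist (u σ) (v σ) ^ 2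

/-- The `ℓ²`-distance between `f` and its translate under a permutation of the positions. -/
noncomputable def displacementSeminorm (f : (ι ≃ κ) → ℝ) : GroupSeminorm (Perm ι) where
  toFun g := dist (WithLp.toLp 2 f) (WithLp.toLp 2 fun σ => f (g.trans σ))
  map_one' := dist_self _
  mul_le' g g' :=
    (dist_triangle _ _ _).trans_eq <| congrArg _ (dist_toLp_trans g f fun σ => f (g'.trans σ))
  inv' g := by
    rw [dist_comm, ← dist_toLp_trans g]
    congr! with σ
    ext x
    simp

theorem displacementSeminorm_indicator {X : Finset (ι ≃ κ)} {g : Perm ι}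
    (hg : ∀ σ, g.trans σ ∈ X ↔ σ ∈ X) (f : (ι ≃ κ) → ℝ) :
    displacementSeminorm ((X : Set (ι ≃ κ)).indicator f) g = √(dirichletForm X f g) := by
  refine (EuclideanSpace.dist_eq _ _).trans (congrArg Real.sqrt ?_)
  rw [dirichletForm_eq_sum_of_forall_mem fun σ hσ => (hg σ).2 hσ,
    ← Finset.sum_indicator_subset _ (Finset.subset_univ X)]
  refine Finset.sum_congr rfl fun σ _ => ?_
  by_cases hσ : σ ∈ X <;> simp [hσ, hg, Real.dist_eq]

end Displacement

theorem dirichletForm_le_of_support_subset [Finite κ] {X : Finset (ι ≃ κ)} {h : ι} {J : Finset ι}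
    (hJ : ∀ j ∈ J, ∀ σ, (swap j h).trans σ ∈ X ↔ σ ∈ X) {g : Perm ι}
    (hg : ∀ σ, g.trans σ ∈ X ↔ σ ∈ X) (hsupp : g.support ⊆ insert h J) {p : ι → ℝ}
    (hp : ∀ j ∈ J, 0 < p j) (f : (ι ≃ κ) → ℝ) :
    dirichletForm X f g ≤
      4 * ((∑ j ∈ J, 1 / p j) * ∑ j ∈ J, p j * dirichletForm X f (swap j h)) := by
  cases nonempty_fintype κ
  have hE := dirichletForm_nonneg X f
  have hsqrt : √(dirichletForm X f g) ≤ 2 * ∑ j ∈ J, √(dirichletForm X f (swap j h)) := by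
    set c := displacementSeminorm ((X : Set (ι ≃ κ)).indicator f) with hc
    have hstar := add_swap_le_two_mul_sum_swap c hsupp
    rw [Finset.sum_congr rfl fun j hj => displacementSeminorm_indicator (hJ j hj) f, hc,
      displacementSeminorm_indicator hg] at hstar
    linarith [apply_nonneg c (swap (g h) h)]
  calc dirichletForm X f g = √(dirichletForm X f g) ^ 2 := (Real.sq_sqrt (hE g)).symm
    _ ≤ (2 * ∑ j ∈ J, √(dirichletForm X f (swap j h))) ^ 2 := by gcongr
    _ = 4 * (∑ j ∈ J, √(dirichletForm X f (swap j h))) ^ 2 := by ring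
    _ ≤ _ := by
        gcongr
        refine Finset.sum_sq_le_sum_mul_sum_of_sq_le_mul _
          (fun j hj => (one_div_pos.2 (hp j hj)).le)
          (fun j hj => mul_nonneg (hp j hj).le (hE _)) fun j hj => ?_
        rw [Real.sq_sqrt (hE _), one_div, inv_mul_cancel_left₀ (hp j hj).ne']

end DirichletForm

section SqDiffSum

variable {α : Type*}

/-- The sum of the squared differences of `f` between the points of `P` and those of `Q`. For
`P = Q` it is `2 * #P ^ 2` times the variance of `f` on `P`. -/
def sqDiffSum (P Q : Finset α) (f : α → ℝ) : ℝ :=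
  ∑ x ∈ P, ∑ y ∈ Q, (f x - f y) ^ 2

theorem sqDiffSum_nonneg (P Q : Finset α) (f : α → ℝ) : 0 ≤ sqDiffSum P Q f :=
  Finset.sum_nonneg fun _ _ => Finset.sum_nonneg fun _ _ => sq_nonneg _

theorem sqDiffSum_eq_sum_fiberwise {κ : Type*} [DecidableEq κ] {X : Finset α} {Z : Finset κ}
    {c : α → κ} (hc : ∀ x ∈ X, c x ∈ Z) (f : α → ℝ) :
    sqDiffSum X X f = ∑ z ∈ Z, ∑ z' ∈ Z, sqDiffSum {x ∈ X | c x = z} {x ∈ X | c x = z'} f := by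
  simp only [sqDiffSum]
  simp_rw [Finset.sum_comm (s := Z) (t := Finset.filter _ _), Finset.sum_fiberwise_of_maps_to hc]

/-- Each pair of points of `P` and `Q` is joined by the paths through the pairs `w`, `φ w`. -/
theorem card_mul_sqDiffSum_le_of_injOn {P Q W : Finset α} {φ : α → α} (hW : W ⊆ P)
    (hφ : Set.MapsTo φ W Q) (hinj : Set.InjOn φ W) (f : α → ℝ) :
    (W.card : ℝ) * sqDiffSum P Q f ≤
      3 * (Q.card * sqDiffSum P P f + P.card * Q.card * ∑ w ∈ W, (f w - f (φ w)) ^ 2 +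
        P.card * sqDiffSum Q Q f) := by
  classical
  have hpath (x y : α) : (W.card : ℝ) * (f x - f y) ^ 2 ≤
      3 * (∑ w ∈ W, (f x - f w) ^ 2 + ∑ w ∈ W, (f w - f (φ w)) ^ 2 +
        ∑ w ∈ W, (f (φ w) - f y) ^ 2) := by
    rw [← Finset.sum_add_distrib, ← Finset.sum_add_distrib, Finset.mul_sum, ← nsmul_eq_mul]
    exact Finset.card_nsmul_le_sum _ _ _ fun w _ => sq_sub_le_three_mul _ _ _ _
  have himage (y : α) : ∑ w ∈ W, (f (φ w) - f y) ^ 2 ≤ ∑ w ∈ Q, (f y - f w) ^ 2 := by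
    rw [← Finset.sum_image (g := φ) (f := fun w => (f w - f y) ^ 2) hinj]
    simp only [sub_sq_comm (f y)]
    exact Finset.sum_le_sum_of_subset_of_nonneg (Finset.image_subset_iff.2 hφ)
      fun _ _ _ => sq_nonneg _
  calc (W.card : ℝ) * sqDiffSum P Q f
      ≤ ∑ x ∈ P, ∑ y ∈ Q, 3 * (∑ w ∈ P, (f x - f w) ^ 2 + ∑ w ∈ W, (f w - f (φ w)) ^ 2 +
          ∑ w ∈ Q, (f y - f w) ^ 2) := by
        simp only [sqDiffSum, Finset.mul_sum (s := P), Finset.mul_sum (s := Q)]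
        refine Finset.sum_le_sum fun x _ => Finset.sum_le_sum fun y _ => (hpath x y).trans ?_
        gcongr
        exact himage y
    _ = _ := by
        simp only [sqDiffSum, ← Finset.mul_sum, Finset.sum_add_distrib, Finset.sum_const,
          nsmul_eq_mul]
        ring

theorem sqDiffSum_le_of_injOn {P Q W : Finset α} {φ : α → α} {K : ℕ} (hW : W ⊆ P)
    (hφ : Set.MapsTo φ W Q) (hinj : Set.InjOn φ W) (hP : P.card ≤ K * W.card)
    (hQ : Q.card ≤ K * W.card) (f : α → ℝ) :
    sqDiffSum P Q f ≤
      3 * K * (sqDiffSum P P f + P.card * ∑ w ∈ W, (f w - f (φ w)) ^ 2 + sqDiffSum Q Q f) := by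
  obtain rfl | hne := W.eq_empty_or_nonempty
  · obtain rfl : P = ∅ := by simpa using hP
    obtain rfl : Q = ∅ := by simpa using hQ
    simp [sqDiffSum]
  have hP' : (P.card : ℝ) ≤ K * W.card := by exact_mod_cast hP
  have hQ' : (Q.card : ℝ) ≤ K * W.card := by exact_mod_cast hQ
  have hWpos : (0 : ℝ) < W.card := by exact_mod_cast hne.card_pos
  refine le_of_mul_le_mul_left ((card_mul_sqDiffSum_le_of_injOn hW hφ hinj f).trans ?_) hWpos
  calc _ ≤ 3 * (K * W.card * sqDiffSum P P f +
          P.card * (K * W.card) * ∑ w ∈ W, (f w - f (φ w)) ^ 2 +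
          K * W.card * sqDiffSum Q Q f) := by
        gcongr <;> exact sqDiffSum_nonneg _ _ f
    _ = _ := by ring

end SqDiffSum

section Exchange

variable {ι κ : Type*} [DecidableEq ι]

/-- Exchange the values of `σ` at `a` and at the position of the colour `c`, so that `a` receives
`c`. -/
def exchange (a : ι) (c : κ) (σ : ι ≃ κ) : ι ≃ κ :=
  (swap a (σ.symm c)).trans σ

theorem exchange_apply (a : ι) (c : κ) (σ : ι ≃ κ) : exchange a c σ a = c := by
  simp [exchange]

theorem exchange_symm_apply (a : ι) (c : κ) (σ : ι ≃ κ) :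
    (exchange a c σ).symm (σ a) = σ.symm c := by
  simp [exchange]

theorem exchange_exchange (a : ι) (c : κ) (σ : ι ≃ κ) :
    exchange a (σ a) (exchange a c σ) = σ := by
  rw [exchange, exchange_symm_apply, exchange, ← Equiv.trans_assoc, swap_swap, Equiv.refl_trans]

variable [DecidableEq κ]

/-- The bijections in `X` with the colour `z` at `a` and the colour `z'` at a position in `F`. The
map `exchange a z'` pairs them with those in which `z` and `z'` play the opposite roles. -/
def exchangeable (X : Finset (ι ≃ κ)) (F : Finset ι) (a : ι) (z z' : κ) : Finset (ι ≃ κ) :=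
  {σ ∈ X | σ a = z ∧ σ.symm z' ∈ F}

theorem exchangeable_subset (X : Finset (ι ≃ κ)) (F : Finset ι) (a : ι) (z z' : κ) :
    exchangeable X F a z z' ⊆ {σ ∈ X | σ a = z} :=
  Finset.monotone_filter_right X fun _ _ hσ => hσ.1

theorem injOn_exchange {X : Finset (ι ≃ κ)} {F : Finset ι} (a : ι) (z z' : κ) :
    Set.InjOn (exchange a z') (exchangeable X F a z z') :=
  Set.LeftInvOn.injOn (f₁' := exchange a z) fun σ hσ => by
    obtain rfl : σ a = z := (Finset.mem_filter.1 hσ).2.1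
    exact exchange_exchange a z' σ

variable [Fintype ι]

theorem sum_exchangeable_le {X : Finset (ι ≃ κ)} {F : Finset ι} {a : ι} {Z : Finset κ}
    (hX : ∀ z ∈ Z, ∀ z' ∈ Z, Set.MapsTo (exchange a z') (exchangeable X F a z z') X)
    (f : (ι ≃ κ) → ℝ) :
    ∑ z ∈ Z, ∑ z' ∈ Z, ∑ σ ∈ exchangeable X F a z z', (f σ - f (exchange a z' σ)) ^ 2 ≤
      ∑ j ∈ F, dirichletForm X f (swap a j) := by
  have hsplit (z z' : κ) : ∑ σ ∈ exchangeable X F a z z', (f σ - f (exchange a z' σ)) ^ 2 =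
      ∑ j ∈ F, ∑ σ ∈ exchangeable X F a z z' with σ.symm z' = j,
        (f σ - f (exchange a z' σ)) ^ 2 :=
    (Finset.sum_fiberwise_of_maps_to (fun σ hσ => (Finset.mem_filter.1 hσ).2.2) _).symm
  simp only [hsplit]
  rw [← Finset.sum_product', Finset.sum_comm]
  refine Finset.sum_le_sum fun j _ => ?_
  calc ∑ w ∈ Z ×ˢ Z, ∑ σ ∈ exchangeable X F a w.1 w.2 with σ.symm w.2 = j,
        (f σ - f (exchange a w.2 σ)) ^ 2
      ≤ ∑ w ∈ Z ×ˢ Z, ∑ σ ∈ {σ ∈ X | (swap a j).trans σ ∈ X} with (σ a, σ j) = w,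
          (f σ - f ((swap a j).trans σ)) ^ 2 := by
        refine Finset.sum_le_sum fun w hw => ?_
        obtain ⟨hz, hz'⟩ := Finset.mem_product.1 hw
        rw [Finset.sum_congr rfl fun σ hσ => by rw [exchange, (Finset.mem_filter.1 hσ).2]]
        refine Finset.sum_le_sum_of_subset_of_nonneg (fun σ hσ => ?_) fun _ _ _ => sq_nonneg _
        obtain ⟨hmem, rfl⟩ := Finset.mem_filter.1 hσ
        obtain ⟨hσX, hσa, -⟩ := Finset.mem_filter.1 hmem
        simp only [Finset.mem_filter, σ.apply_symm_apply, hσa, Prod.mk.eta, and_true]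
        exact ⟨hσX, hX _ hz _ hz' hmem⟩
    _ ≤ dirichletForm X f (swap a j) :=
        Finset.sum_fiberwise_le_sum_of_sum_fiber_nonneg
          fun _ _ => Finset.sum_nonneg fun _ _ => sq_nonneg _

end Exchange

section Constrained

variable {ι κ : Type*} [DecidableEq ι] [DecidableEq κ]

/-- The lists after the colour `z` has been given to the position `a`. -/
def pin (A : ι → Finset κ) (a : ι) (z : κ) (i : ι) : Finset κ :=
  if i = a then {z} else (A i).erase z

/-- Lists `A` in which the positions in `S` are constrained, those in `F` are free, that is, have
the same list as the hole `h ∈ F`, and all others are frozen, as arises by pinning constrained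
positions. -/
structure IsConstrained (A : ι → Finset κ) (S F : Finset ι) (h : ι) : Prop where
  hole_mem : h ∈ F
  disjoint : Disjoint S F
  free : ∀ j ∈ F, A j = A h
  subset : ∀ i ∈ S, A i ⊆ A h
  card_lt : ∀ i ∈ S, S.card < (A i).card
  frozen : ∀ i ∉ S, i ∉ F → (A i).card ≤ 1 ∧ Disjoint (A i) (A h)

namespace IsConstrained

variable {A : ι → Finset κ} {S F : Finset ι} {h : ι}

theorem pin_erase (hA : IsConstrained A S F h) {a : ι} (ha : a ∈ S) (z : κ) :
    IsConstrained (pin A a z) (S.erase a) F h where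
  hole_mem := hA.hole_mem
  disjoint := hA.disjoint.mono_left (Finset.erase_subset _ _)
  free j hj := by
    have hja : j ≠ a := (hA.disjoint.forall_ne_finset ha hj).symm
    have hha : h ≠ a := (hA.disjoint.forall_ne_finset ha hA.hole_mem).symm
    rw [pin, pin, if_neg hja, if_neg hha, hA.free j hj]
  subset i hi := by
    have hha : h ≠ a := (hA.disjoint.forall_ne_finset ha hA.hole_mem).symm
    rw [pin, pin, if_neg (Finset.ne_of_mem_erase hi), if_neg hha]
    exact Finset.erase_subset_erase _ (hA.subset i (Finset.mem_of_mem_erase hi))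
  card_lt i hi := by
    rw [pin, if_neg (Finset.ne_of_mem_erase hi), Finset.card_erase_of_mem ha]
    have := hA.card_lt i (Finset.mem_of_mem_erase hi)
    have := Finset.pred_card_le_card_erase (s := A i) (a := z)
    have := Finset.card_pos.2 ⟨a, ha⟩
    omega
  frozen i hiS hiF := by
    have hha : h ≠ a := (hA.disjoint.forall_ne_finset ha hA.hole_mem).symm
    rw [pin, pin, if_neg hha]
    split_ifs with hia
    · exact ⟨Finset.card_singleton z |>.le, by simp⟩
    · have hi := hA.frozen i (fun hi => hiS (Finset.mem_erase.2 ⟨hia, hi⟩)) hiF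
      exact ⟨(Finset.card_erase_le).trans hi.1,
        hi.2.mono (Finset.erase_subset _ _) (Finset.erase_subset _ _)⟩

end IsConstrained

end Constrained

section ListBijections

variable {ι κ : Type*} [Fintype ι] [Fintype κ] [DecidableEq ι] [DecidableEq κ]

/-- The bijections from positions to colours that respect the lists `A`. -/
def listBijections (A : ι → Finset κ) : Finset (ι ≃ κ) :=
  {σ | ∀ i, σ i ∈ A i}

theorem mem_listBijections {A : ι → Finset κ} {σ : ι ≃ κ} :
    σ ∈ listBijections A ↔ ∀ i, σ i ∈ A i := by
  simp only [listBijections, Finset.mem_filter, Finset.mem_univ, true_and]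

theorem trans_mem_listBijections_iff {A : ι → Finset κ} {g : Perm ι} (hg : ∀ i, A (g i) = A i)
    (σ : ι ≃ κ) : g.trans σ ∈ listBijections A ↔ σ ∈ listBijections A := by
  rw [mem_listBijections, mem_listBijections, ← g.forall_congr_right (q := fun i => σ i ∈ A i)]
  simp only [hg, Equiv.trans_apply]

theorem exchange_mem_listBijections {A : ι → Finset κ} {σ : ι ≃ κ} (hσ : σ ∈ listBijections A)
    {a : ι} {c : κ} (hc : c ∈ A a) (ha : σ a ∈ A (σ.symm c)) :
    exchange a c σ ∈ listBijections A := by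
  rw [mem_listBijections] at hσ ⊢
  intro i
  rw [exchange, Equiv.trans_apply, swap_apply_def]
  split_ifs with hia hic
  · rwa [hia, Equiv.apply_symm_apply]
  · rwa [hic]
  · exact hσ i

theorem listBijections_pin {A : ι → Finset κ} {a : ι} {z : κ} (hz : z ∈ A a) :
    listBijections (pin A a z) = {σ ∈ listBijections A | σ a = z} := by
  ext σ
  simp only [Finset.mem_filter, mem_listBijections, pin]
  refine ⟨fun hσ => ?_, fun ⟨hσ, hσa⟩ i => ?_⟩
  · have ha : σ a = z := by simpa using hσ a
    refine ⟨fun i => ?_, ha⟩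
    have := hσ i
    grind
  · have := hσ i
    have hne (hia : i ≠ a) : σ i ≠ z := hσa ▸ σ.injective.ne hia
    grind

namespace IsConstrained

variable {A : ι → Finset κ} {S F : Finset ι} {h : ι}

theorem mem_or_mem (hA : IsConstrained A S F h) {σ : ι ≃ κ} (hσ : σ ∈ listBijections A) {i : ι}
    (hi : σ i ∈ A h) : i ∈ S ∨ i ∈ F := by
  by_contra! hfrozen
  exact Finset.disjoint_left.1 (hA.frozen i hfrozen.1 hfrozen.2).2 (mem_listBijections.1 hσ i) hi

theorem trans_mem_iff (hA : IsConstrained A S F h) {g : Perm ι} (hg : g.support ⊆ F) (σ : ι ≃ κ) :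
    g.trans σ ∈ listBijections A ↔ σ ∈ listBijections A := by
  refine trans_mem_listBijections_iff (fun i => ?_) σ
  by_cases hi : g i = i
  · rw [hi]
  · have hmem : i ∈ g.support := Perm.mem_support.2 hi
    rw [hA.free _ (hg hmem), hA.free _ (hg (Perm.apply_mem_support.2 hmem))]

theorem swap_trans_mem_iff (hA : IsConstrained A S F h) {j : ι} (hj : j ∈ F) (σ : ι ≃ κ) :
    (swap j h).trans σ ∈ listBijections A ↔ σ ∈ listBijections A := by
  refine hA.trans_mem_iff (fun x hx => ?_) σ
  have := hA.hole_mem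
  rw [Perm.mem_support, swap_apply_def] at hx
  grind

/-- The constrained positions cannot use up `A i`. -/
theorem exists_exchange_mem (hA : IsConstrained A S F h) {σ : ι ≃ κ} (hσ : σ ∈ listBijections A)
    {i : ι} (hi : i ∈ S) :
    ∃ c, exchange i c σ ∈ listBijections A ∧ σ.symm c ∈ F := by
  obtain ⟨c, hci, hcS⟩ : ∃ c ∈ A i, c ∉ S.image σ :=
    Finset.exists_mem_notMem_of_card_lt_card (Finset.card_image_le.trans_lt (hA.card_lt i hi))
  have hcF : σ.symm c ∈ F := by
    refine (hA.mem_or_mem hσ (i := σ.symm c) ?_).resolve_left fun hS =>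
      hcS (Finset.mem_image.2 ⟨_, hS, σ.apply_symm_apply c⟩)
    rw [σ.apply_symm_apply]
    exact hA.subset i hi hci
  refine ⟨c, exchange_mem_listBijections hσ hci ?_, hcF⟩
  rw [hA.free _ hcF]
  exact hA.subset i hi (mem_listBijections.1 hσ i)

theorem card_listBijections_le (hA : IsConstrained A S F h) {z : κ} (hz : z ∈ A h) :
    (listBijections A).card ≤ (S.card + 1) * {σ ∈ listBijections A | σ.symm z ∈ F}.card := by
  set W := {σ ∈ listBijections A | σ.symm z ∈ F}
  have hcover : listBijections A ⊆ W ∪ S.biUnion fun i => W.image (exchange i z) := by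
    intro σ hσ
    rw [Finset.mem_union, Finset.mem_biUnion]
    refine (hA.mem_or_mem hσ (i := σ.symm z) (by rwa [σ.apply_symm_apply])).symm.imp
      (fun hF => Finset.mem_filter.2 ⟨hσ, hF⟩) fun hS => ⟨_, hS, ?_⟩
    obtain ⟨c, hmem, hcF⟩ := hA.exists_exchange_mem hσ hS
    have hsymm := exchange_symm_apply (σ.symm z) c σ
    have hback := exchange_exchange (σ.symm z) c σ
    rw [σ.apply_symm_apply] at hsymm hback
    exact Finset.mem_image.2 ⟨_, Finset.mem_filter.2 ⟨hmem, by rwa [hsymm]⟩, hback⟩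
  calc (listBijections A).card ≤ W.card + ∑ i ∈ S, (W.image (exchange i z)).card :=
        (Finset.card_le_card hcover).trans <| (Finset.card_union_le _ _).trans <|
          Nat.add_le_add_left Finset.card_biUnion_le _
    _ ≤ W.card + ∑ _i ∈ S, W.card :=
        Nat.add_le_add_left (Finset.sum_le_sum fun _ _ => Finset.card_image_le) _
    _ = (S.card + 1) * W.card := by
        rw [Finset.sum_const, smul_eq_mul]
        ring

end IsConstrained

end ListBijections

section Fibers

variable {ι κ : Type*} [Fintype ι] [Fintype κ] [DecidableEq ι] [DecidableEq κ]

namespace IsConstrained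

variable {A : ι → Finset κ} {S F : Finset ι} {h a : ι} {z z' : κ}

theorem mapsTo_exchange (hA : IsConstrained A S F h) (ha : a ∈ S) (hz : z ∈ A a) (hz' : z' ∈ A a) :
    Set.MapsTo (exchange a z') (exchangeable (listBijections A) F a z z')
      (exchangeable (listBijections A) F a z' z) := by
  intro σ hσ
  obtain ⟨hmem, hσa, hF⟩ := Finset.mem_filter.1 hσ
  refine Finset.mem_filter.2 ⟨exchange_mem_listBijections hmem hz' ?_, exchange_apply a z' σ, ?_⟩
  · rw [hσa, hA.free _ hF]
    exact hA.subset a ha hz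
  · rwa [← hσa, exchange_symm_apply]

theorem card_exchangeable_le (hA : IsConstrained A S F h) (ha : a ∈ S) (hz : z ∈ A a)
    (hz' : z' ∈ A a) :
    (exchangeable (listBijections A) F a z z').card ≤
      (exchangeable (listBijections A) F a z' z).card :=
  Finset.card_le_card_of_injOn _ (hA.mapsTo_exchange ha hz hz') (injOn_exchange a z z')

theorem card_fiber_le_mul_card_exchangeable (hA : IsConstrained A S F h) (ha : a ∈ S)
    (hz : z ∈ A a) (hz' : z' ∈ A a) (hne : z ≠ z') :
    {σ ∈ listBijections A | σ a = z}.card ≤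
      S.card * (exchangeable (listBijections A) F a z z').card := by
  have hfree : z' ∈ pin A a z h := by
    rw [pin, if_neg (hA.disjoint.forall_ne_finset ha hA.hole_mem).symm]
    exact Finset.mem_erase.2 ⟨hne.symm, hA.subset a ha hz'⟩
  have hle := (hA.pin_erase ha z).card_listBijections_le hfree
  rwa [Finset.card_erase_add_one ha, listBijections_pin hz, Finset.filter_filter] at hle

theorem card_fiber_le (hA : IsConstrained A S F h) (ha : a ∈ S) (hz : z ∈ A a) (hz' : z' ∈ A a) :
    {σ ∈ listBijections A | σ a = z}.card ≤
      S.card * {σ ∈ listBijections A | σ a = z'}.card := by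
  obtain rfl | hne := eq_or_ne z z'
  · exact Nat.le_mul_of_pos_left _ (Finset.card_pos.2 ⟨a, ha⟩)
  calc _ ≤ S.card * (exchangeable (listBijections A) F a z z').card :=
        hA.card_fiber_le_mul_card_exchangeable ha hz hz' hne
    _ ≤ S.card * (exchangeable (listBijections A) F a z' z).card :=
        Nat.mul_le_mul_left _ (hA.card_exchangeable_le ha hz hz')
    _ ≤ _ := Nat.mul_le_mul_left _ (Finset.card_le_card (exchangeable_subset _ F a z' z))

theorem card_mul_card_fiber_le (hA : IsConstrained A S F h) (ha : a ∈ S) (hz : z ∈ A a) :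
    (A a).card * {σ ∈ listBijections A | σ a = z}.card ≤ S.card * (listBijections A).card := by
  rw [Finset.card_eq_sum_card_fiberwise (s := listBijections A) (t := A a)
    fun σ hσ => mem_listBijections.1 hσ a, Finset.mul_sum, ← smul_eq_mul]
  exact Finset.card_nsmul_le_sum _ _ _ fun z' hz' => hA.card_fiber_le ha hz hz'

theorem sqDiffSum_fiber_le (hA : IsConstrained A S F h) (ha : a ∈ S) (hz : z ∈ A a)
    (hz' : z' ∈ A a) (f : (ι ≃ κ) → ℝ) :
    sqDiffSum {σ ∈ listBijections A | σ a = z} {σ ∈ listBijections A | σ a = z'} f ≤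
      3 * S.card * (sqDiffSum {σ ∈ listBijections A | σ a = z} {σ ∈ listBijections A | σ a = z} f +
        {σ ∈ listBijections A | σ a = z}.card *
          ∑ σ ∈ exchangeable (listBijections A) F a z z', (f σ - f (exchange a z' σ)) ^ 2 +
        sqDiffSum {σ ∈ listBijections A | σ a = z'} {σ ∈ listBijections A | σ a = z'} f) := by
  obtain rfl | hne := eq_or_ne z z'
  · have hS : (1 : ℝ) ≤ S.card := by exact_mod_cast Finset.card_pos.2 ⟨a, ha⟩
    have hV := sqDiffSum_nonneg {σ ∈ listBijections A | σ a = z} {σ ∈ listBijections A | σ a = z} f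
    have hD : 0 ≤ ({σ ∈ listBijections A | σ a = z}.card : ℝ) *
        ∑ σ ∈ exchangeable (listBijections A) F a z z, (f σ - f (exchange a z σ)) ^ 2 := by
      positivity
    nlinarith
  · refine sqDiffSum_le_of_injOn (exchangeable_subset _ F a z z')
      ((hA.mapsTo_exchange ha hz hz').mono_right (exchangeable_subset _ F a z' z))
      (injOn_exchange a z z') (hA.card_fiber_le_mul_card_exchangeable ha hz hz' hne) ?_ f
    exact (hA.card_fiber_le_mul_card_exchangeable ha hz' hz hne.symm).trans
      (Nat.mul_le_mul_left _ (hA.card_exchangeable_le ha hz' hz))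

end IsConstrained

end Fibers

section HoleEnergy

variable {ι κ : Type*} [DecidableEq ι]

/-- The cost of the rates `p` in the Poincaré inequality for lists that are constrained on `S` and
free on `F`; the position `h` is the hole, which has no rate. -/
noncomputable def rateCost (p : ι → ℝ) (S F : Finset ι) (h : ι) : ℝ :=
  ∑ i ∈ S, F.card / p i + ∑ j ∈ F.erase h, 1 / p j

theorem rateCost_nonneg {p : ι → ℝ} (hp : ∀ i, 0 < p i) (S F : Finset ι) (h : ι) :
    0 ≤ rateCost p S F h :=
  add_nonneg (Finset.sum_nonneg fun i _ => div_nonneg (Nat.cast_nonneg _) (hp i).le)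
    (Finset.sum_nonneg fun i _ => one_div_nonneg.2 (hp i).le)

theorem rateCost_mono_left {p : ι → ℝ} (hp : ∀ i, 0 < p i) {S S' : Finset ι} (hS : S ⊆ S')
    (F : Finset ι) (h : ι) : rateCost p S F h ≤ rateCost p S' F h :=
  add_le_add_left (Finset.sum_le_sum_of_subset_of_nonneg hS
    fun i _ _ => div_nonneg (Nat.cast_nonneg _) (hp i).le) _

variable [Fintype ι] [DecidableEq κ]

/-- The energy of `f` under the moves that exchange the value at a position `i` with the value at
the hole `h` at rate `p i`. -/
def holeEnergy (p : ι → ℝ) (X : Finset (ι ≃ κ)) (h : ι) (f : (ι ≃ κ) → ℝ) : ℝ :=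
  ∑ i, p i * dirichletForm X f (swap i h)

theorem sum_mul_dirichletForm_le_holeEnergy {p : ι → ℝ} (hp : ∀ i, 0 < p i) (X : Finset (ι ≃ κ))
    (J : Finset ι) (h : ι) (f : (ι ≃ κ) → ℝ) :
    ∑ j ∈ J, p j * dirichletForm X f (swap j h) ≤ holeEnergy p X h f :=
  Finset.sum_le_sum_of_subset_of_nonneg (Finset.subset_univ J)
    fun i _ _ => mul_nonneg (hp i).le (dirichletForm_nonneg X f _)

theorem holeEnergy_nonneg {p : ι → ℝ} (hp : ∀ i, 0 < p i) (X : Finset (ι ≃ κ)) (h : ι)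
    (f : (ι ≃ κ) → ℝ) : 0 ≤ holeEnergy p X h f :=
  Finset.sum_nonneg fun i _ => mul_nonneg (hp i).le (dirichletForm_nonneg X f _)

theorem dirichletForm_le_holeEnergy_div {p : ι → ℝ} (hp : ∀ i, 0 < p i) (X : Finset (ι ≃ κ))
    (h i : ι) (f : (ι ≃ κ) → ℝ) :
    dirichletForm X f (swap i h) ≤ holeEnergy p X h f / p i := by
  rw [le_div_iff₀' (hp i)]
  simpa using sum_mul_dirichletForm_le_holeEnergy hp X {i} h f

theorem sum_holeEnergy_fiber_le {p : ι → ℝ} (hp : ∀ i, 0 < p i) (X : Finset (ι ≃ κ)) (h a : ι)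
    (Z : Finset κ) (f : (ι ≃ κ) → ℝ) :
    ∑ z ∈ Z, holeEnergy p {σ ∈ X | σ a = z} h f ≤ holeEnergy p X h f := by
  simp only [holeEnergy]
  rw [Finset.sum_comm]
  simp only [← Finset.mul_sum]
  exact Finset.sum_le_sum fun i _ =>
    mul_le_mul_of_nonneg_left (sum_dirichletForm_filter_le X f _ a Z) (hp i).le

theorem sum_dirichletForm_swap_le {p : ι → ℝ} (hp : ∀ i, 0 < p i) {X : Finset (ι ≃ κ)}
    {S F : Finset ι} {a h : ι} (ha : a ∈ S) (hh : h ∈ F) (hSF : Disjoint S F)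
    (hX : ∀ j ∈ F, ∀ σ, (swap j h).trans σ ∈ X ↔ σ ∈ X) (f : (ι ≃ κ) → ℝ) :
    ∑ j ∈ F, dirichletForm X f (swap a j) ≤ 6 * (rateCost p S F h * holeEnergy p X h f) := by
  set E := holeEnergy p X h f
  have hE0 : 0 ≤ E := holeEnergy_nonneg hp X h f
  have hEp (i : ι) : 0 ≤ E / p i := div_nonneg hE0 (hp i).le
  have hfree : ∑ j ∈ F, dirichletForm X f (swap j h) ≤ ∑ j ∈ F.erase h, E / p j := by
    rw [← Finset.add_sum_erase _ _ hh, swap_self, ← Perm.one_def, dirichletForm_one, zero_add]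
    exact Finset.sum_le_sum fun j _ => dirichletForm_le_holeEnergy_div hp X h j f
  have hconstrained : F.card * (E / p a) ≤ ∑ i ∈ S, F.card * (E / p i) :=
    Finset.single_le_sum (f := fun i => F.card * (E / p i))
      (fun i _ => mul_nonneg (Nat.cast_nonneg _) (hEp i)) ha
  calc ∑ j ∈ F, dirichletForm X f (swap a j)
      ≤ ∑ j ∈ F, 3 * (2 * dirichletForm X f (swap j h) + E / p a) := by
        refine Finset.sum_le_sum fun j hj => (dirichletForm_swap_le (hSF.forall_ne_finset ha hh)
          (hSF.forall_ne_finset ha hj) (hX j hj) f).trans ?_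
        gcongr
        exact dirichletForm_le_holeEnergy_div hp X h a f
    _ = 6 * ∑ j ∈ F, dirichletForm X f (swap j h) + 3 * (F.card * (E / p a)) := by
        rw [← Finset.mul_sum, Finset.sum_add_distrib, ← Finset.mul_sum, Finset.sum_const,
          nsmul_eq_mul]
        ring
    _ ≤ 6 * ∑ j ∈ F.erase h, E / p j + 6 * ∑ i ∈ S, F.card * (E / p i) := by
        have := Finset.sum_nonneg fun i (_ : i ∈ S) => mul_nonneg F.card.cast_nonneg (hEp i)
        linarith
    _ = 6 * (rateCost p S F h * E) := by
        simp only [rateCost, add_mul, Finset.sum_mul, div_mul_eq_mul_div, one_mul, mul_div_assoc]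
        ring

end HoleEnergy

section Poincare

variable {ι κ : Type*} [Fintype ι] [Fintype κ] [DecidableEq ι] [DecidableEq κ]

namespace IsConstrained

variable {A : ι → Finset κ} {S F : Finset ι} {h a : ι} {p : ι → ℝ}

theorem sum_listBijections_eq_sum_perm (hA : IsConstrained A ∅ F h) {σ : ι ≃ κ}
    (hσ : σ ∈ listBijections A) (G : (ι ≃ κ) → ℝ) :
    ∑ η ∈ listBijections A, G η = ∑ g : Perm ι with g.support ⊆ F, G (g.trans σ) := by
  refine Finset.sum_nbij' (fun η => η.trans σ.symm) (fun g => g.trans σ) (fun η hη => ?_)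
    (fun g hg => (hA.trans_mem_iff (Finset.mem_filter.1 hg).2 σ).2 hσ)
    (fun η _ => by simp [Equiv.trans_assoc]) (fun g _ => by simp [Equiv.trans_assoc])
    (fun η _ => by simp [Equiv.trans_assoc])
  refine Finset.mem_filter.2 ⟨Finset.mem_univ _, fun i hi => ?_⟩
  by_contra hiF
  have heq : η i = σ i := Finset.card_le_one.1 (hA.frozen i (Finset.notMem_empty i) hiF).1
    _ (mem_listBijections.1 hη i) _ (mem_listBijections.1 hσ i)
  exact Perm.mem_support.1 hi (σ.symm_apply_eq.2 heq)

theorem sqDiffSum_le_of_empty (hA : IsConstrained A ∅ F h) (hp : ∀ i, 0 < p i)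
    (f : (ι ≃ κ) → ℝ) :
    sqDiffSum (listBijections A) (listBijections A) f ≤
      4 * (listBijections A).card * (rateCost p ∅ F h * holeEnergy p (listBijections A) h f) := by
  set X := listBijections A
  set G : Finset (Perm ι) := {g | g.support ⊆ F}
  obtain hempty | ⟨σ₀, hσ₀⟩ := X.eq_empty_or_nonempty
  · simp [hempty, sqDiffSum]
  have hcard : (X.card : ℝ) = G.card := by
    simpa using hA.sum_listBijections_eq_sum_perm hσ₀ fun _ => 1
  have hperm (g : Perm ι) (hg : g ∈ G) :
      dirichletForm X f g ≤ 4 * (rateCost p ∅ F h * holeEnergy p X h f) := by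
    have hg : g.support ⊆ F := (Finset.mem_filter.1 hg).2
    refine (dirichletForm_le_of_support_subset (h := h) (J := F.erase h)
      (fun j hj => hA.swap_trans_mem_iff (Finset.mem_of_mem_erase hj)) (hA.trans_mem_iff hg)
      (by rwa [Finset.insert_erase hA.hole_mem]) (fun j _ => hp j) f).trans ?_
    rw [rateCost, Finset.sum_empty, zero_add]
    gcongr
    · exact Finset.sum_nonneg fun j _ => one_div_nonneg.2 (hp j).le
    · exact sum_mul_dirichletForm_le_holeEnergy hp X _ h f
  calc sqDiffSum X X f = ∑ g ∈ G, dirichletForm X f g := by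
        rw [sqDiffSum, Finset.sum_congr rfl fun σ hσ =>
          hA.sum_listBijections_eq_sum_perm hσ fun η => (f σ - f η) ^ 2, Finset.sum_comm]
        refine Finset.sum_congr rfl fun g hg => (dirichletForm_eq_sum_of_forall_mem ?_ f).symm
        exact fun σ hσ => (hA.trans_mem_iff (Finset.mem_filter.1 hg).2 σ).2 hσ
    _ ≤ G.card • (4 * (rateCost p ∅ F h * holeEnergy p X h f)) :=
        Finset.sum_le_card_nsmul _ _ _ hperm
    _ = _ := by
        rw [nsmul_eq_mul, ← hcard]
        ring

theorem sum_fiber_exchange_le (hA : IsConstrained A S F h) (ha : a ∈ S) (hp : ∀ i, 0 < p i)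
    (f : (ι ≃ κ) → ℝ) :
    ∑ z ∈ A a, ∑ z' ∈ A a, ({σ ∈ listBijections A | σ a = z}.card : ℝ) *
        ∑ σ ∈ exchangeable (listBijections A) F a z z', (f σ - f (exchange a z' σ)) ^ 2 ≤
      (listBijections A).card * (6 * (rateCost p S F h * holeEnergy p (listBijections A) h f)) := by
  set X := listBijections A
  calc _ ≤ ∑ z ∈ A a, ∑ z' ∈ A a, (X.card : ℝ) *
          ∑ σ ∈ exchangeable X F a z z', (f σ - f (exchange a z' σ)) ^ 2 := by
        gcongr
        exact Finset.filter_subset _ X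
    _ = X.card * ∑ z ∈ A a, ∑ z' ∈ A a,
          ∑ σ ∈ exchangeable X F a z z', (f σ - f (exchange a z' σ)) ^ 2 := by
        simp only [Finset.mul_sum]
    _ ≤ X.card * (6 * (rateCost p S F h * holeEnergy p X h f)) := by
        refine mul_le_mul_of_nonneg_left ?_ X.card.cast_nonneg
        exact (sum_exchangeable_le (fun z hz z' hz' => (hA.mapsTo_exchange ha hz hz').mono_right
          fun _ h => (Finset.mem_filter.1 h).1) f).trans <|
          sum_dirichletForm_swap_le hp ha hA.hole_mem hA.disjoint
            (fun j hj => hA.swap_trans_mem_iff hj) f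

theorem card_mul_sum_sqDiffSum_fiber_le (hA : IsConstrained A S F h) (ha : a ∈ S)
    (hp : ∀ i, 0 < p i) (f : (ι ≃ κ) → ℝ) {C : ℝ} (hC : 0 ≤ C)
    (hfiber : ∀ z ∈ A a, sqDiffSum {σ ∈ listBijections A | σ a = z}
      {σ ∈ listBijections A | σ a = z} f ≤ C * {σ ∈ listBijections A | σ a = z}.card *
        (rateCost p (S.erase a) F h * holeEnergy p {σ ∈ listBijections A | σ a = z} h f)) :
    (A a).card * ∑ z ∈ A a, sqDiffSum {σ ∈ listBijections A | σ a = z}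
        {σ ∈ listBijections A | σ a = z} f ≤
      C * (S.card * (listBijections A).card) *
        (rateCost p S F h * holeEnergy p (listBijections A) h f) := by
  set X := listBijections A
  have hR := rateCost_nonneg hp S F h
  have hE (z : κ) := holeEnergy_nonneg hp {σ ∈ X | σ a = z} h f
  calc _ ≤ (A a).card * ∑ z ∈ A a, C * {σ ∈ X | σ a = z}.card *
          (rateCost p S F h * holeEnergy p {σ ∈ X | σ a = z} h f) := by
        refine mul_le_mul_of_nonneg_left (Finset.sum_le_sum fun z hz => (hfiber z hz).trans ?_)
          (Nat.cast_nonneg _)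
        gcongr
        · exact hE z
        · exact rateCost_mono_left hp (Finset.erase_subset a S) F h
    _ = ∑ z ∈ A a, C * ((A a).card * {σ ∈ X | σ a = z}.card) *
          (rateCost p S F h * holeEnergy p {σ ∈ X | σ a = z} h f) := by
        rw [Finset.mul_sum]
        exact Finset.sum_congr rfl fun z _ => by ring
    _ ≤ ∑ z ∈ A a, C * (S.card * X.card) *
          (rateCost p S F h * holeEnergy p {σ ∈ X | σ a = z} h f) := by
        refine Finset.sum_le_sum fun z hz => mul_le_mul_of_nonneg_right
          (mul_le_mul_of_nonneg_left ?_ hC) (mul_nonneg hR (hE z))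
        exact_mod_cast hA.card_mul_card_fiber_le ha hz
    _ ≤ _ := by
        rw [← Finset.mul_sum, ← Finset.mul_sum]
        gcongr
        exact sum_holeEnergy_fiber_le hp X h a (A a) f

theorem sqDiffSum_le_of_fiber (hA : IsConstrained A S F h) (ha : a ∈ S) (hp : ∀ i, 0 < p i)
    (f : (ι ≃ κ) → ℝ) {C : ℝ} (hC : 0 ≤ C)
    (hfiber : ∀ z ∈ A a, sqDiffSum {σ ∈ listBijections A | σ a = z}
      {σ ∈ listBijections A | σ a = z} f ≤ C * {σ ∈ listBijections A | σ a = z}.card *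
        (rateCost p (S.erase a) F h * holeEnergy p {σ ∈ listBijections A | σ a = z} h f)) :
    sqDiffSum (listBijections A) (listBijections A) f ≤
      6 * S.card * (S.card * C + 3) * (listBijections A).card *
        (rateCost p S F h * holeEnergy p (listBijections A) h f) := by
  set X := listBijections A
  set V : κ → ℝ := fun z => sqDiffSum {σ ∈ X | σ a = z} {σ ∈ X | σ a = z} f with hV
  set D : κ → κ → ℝ := fun z z' => ({σ ∈ X | σ a = z}.card : ℝ) *
    ∑ σ ∈ exchangeable X F a z z', (f σ - f (exchange a z' σ)) ^ 2 with hD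
  have hexchange := hA.sum_fiber_exchange_le ha hp f
  have hwithin := hA.card_mul_sum_sqDiffSum_fiber_le ha hp f hC hfiber
  calc sqDiffSum X X f
      = ∑ z ∈ A a, ∑ z' ∈ A a, sqDiffSum {σ ∈ X | σ a = z} {σ ∈ X | σ a = z'} f :=
        sqDiffSum_eq_sum_fiberwise (fun σ hσ => mem_listBijections.1 hσ a) f
    _ ≤ ∑ z ∈ A a, ∑ z' ∈ A a, 3 * S.card * (V z + D z z' + V z') :=
        Finset.sum_le_sum fun z hz => Finset.sum_le_sum fun z' hz' =>
          hA.sqDiffSum_fiber_le ha hz hz' f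
    _ = 3 * S.card * (2 * ((A a).card * ∑ z ∈ A a, V z) + ∑ z ∈ A a, ∑ z' ∈ A a, D z z') := by
        simp only [← Finset.mul_sum, Finset.sum_add_distrib, Finset.sum_const, nsmul_eq_mul]
        ring
    _ ≤ 3 * S.card * (2 * (C * (S.card * X.card) * (rateCost p S F h * holeEnergy p X h f)) +
          X.card * (6 * (rateCost p S F h * holeEnergy p X h f))) := by
        gcongr
    _ = _ := by ring

end IsConstrained

/-- The constant in the Poincaré inequality with `t` constrained positions. -/
def poincareConst : ℕ → ℝ
  | 0 => 4
  | t + 1 => 6 * (t + 1) * ((t + 1) * poincareConst t + 3)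

theorem poincareConst_pos (t : ℕ) : 0 < poincareConst t := by
  induction t with
  | zero => norm_num [poincareConst]
  | succ t ih =>
    rw [poincareConst]
    positivity

theorem IsConstrained.sqDiffSum_le {A : ι → Finset κ} {S F : Finset ι} {h : ι}
    (hA : IsConstrained A S F h) {p : ι → ℝ} (hp : ∀ i, 0 < p i) (f : (ι ≃ κ) → ℝ) :
    sqDiffSum (listBijections A) (listBijections A) f ≤ poincareConst S.card *
      (listBijections A).card * (rateCost p S F h * holeEnergy p (listBijections A) h f) := by
  induction hS : S.card generalizing A S with
  | zero =>
    obtain rfl := Finset.card_eq_zero.1 hS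
    exact hA.sqDiffSum_le_of_empty hp f
  | succ t ih =>
    obtain ⟨a, ha⟩ := Finset.card_pos.1 (t.succ_pos.trans_eq hS.symm)
    have hfiber (z : κ) := ih (hA.pin_erase ha z)
      (by rw [Finset.card_erase_of_mem ha, hS, Nat.add_sub_cancel])
    have hstep := hA.sqDiffSum_le_of_fiber ha hp f (poincareConst_pos t).le fun z hz => by
      simpa only [listBijections_pin hz] using hfiber z
    rw [hS, Nat.cast_succ] at hstep
    exact hstep

end Poincare

section SpectralGap

open Matrix

theorem exists_ne_le_sort_getD_one {ι α : Type*} [Fintype ι] [LinearOrder α] (a : ι → α) (d : α)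
    (hcard : 2 ≤ Fintype.card ι) :
    ∃ i j, i ≠ j ∧ a i ≤ ((Finset.univ.val.map a).sort (· ≤ ·)).getD 1 d ∧
      a j ≤ ((Finset.univ.val.map a).sort (· ≤ ·)).getD 1 d := by
  have hsorted := Multiset.pairwise_sort (Finset.univ.val.map a) (· ≤ ·)
  have hcoe := Multiset.sort_eq (Finset.univ.val.map a) (· ≤ ·)
  have hlen := Multiset.length_sort (s := Finset.univ.val.map a) (r := (· ≤ ·))
  rw [Multiset.card_map, Finset.card_val, Finset.card_univ] at hlen
  generalize (Finset.univ.val.map a).sort (· ≤ ·) = l at *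
  obtain - | ⟨x, - | ⟨y, l⟩⟩ := l
  · simp only [List.length_nil] at hlen
    omega
  · simp only [List.length_singleton] at hlen
    omega
  have hxy : x ≤ y := List.rel_of_pairwise_cons hsorted List.mem_cons_self
  have htwo : 1 < Finset.card {i | a i ≤ y} := by
    calc 1 < Multiset.countP (· ≤ y) ((x :: y :: l : List α) : Multiset α) := by simp [hxy]
      _ = _ := by
        rw [hcoe, Multiset.countP_map]
        rfl
  obtain ⟨i, hi, j, hj, hij⟩ := Finset.one_lt_card.1 htwo
  exact ⟨i, j, hij, (Finset.mem_filter.1 hi).2, (Finset.mem_filter.1 hj).2⟩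

variable {Ω : Type*} [Fintype Ω]

/-- Two orthogonal eigenvectors have a combination of mean zero. -/
theorem le_of_orthonormal_eigenvectors {M : Matrix Ω Ω ℝ} {u v : Ω → ℝ} {a b r s : ℝ}
    (huu : u ⬝ᵥ u = 1) (hvv : v ⬝ᵥ v = 1) (huv : u ⬝ᵥ v = 0) (hu : M *ᵥ u = a • u)
    (hv : M *ᵥ v = b • v) (ha : a ≤ s) (hb : b ≤ s)
    (hr : ∀ g : Ω → ℝ, ∑ x, g x = 0 → r * (g ⬝ᵥ g) ≤ g ⬝ᵥ (M *ᵥ g)) : r ≤ s := by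
  have hvu : v ⬝ᵥ u = 0 := by rw [dotProduct_comm, huv]
  obtain ⟨α, β, hpos, hmean⟩ : ∃ α β : ℝ, 0 < α ^ 2 + β ^ 2 ∧
      α * ∑ x, u x + β * ∑ x, v x = 0 := by
    by_cases hs : ∑ x, u x = 0
    · exact ⟨1, 0, by norm_num, by simp [hs]⟩
    · exact ⟨-∑ x, v x, ∑ x, u x, by positivity, by ring⟩
  have hnorm : (α • u + β • v) ⬝ᵥ (α • u + β • v) = α ^ 2 + β ^ 2 := by
    simp only [add_dotProduct, dotProduct_add, smul_dotProduct, dotProduct_smul, huu, hvv, huv,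
      hvu, smul_eq_mul]
    ring
  have hform : (α • u + β • v) ⬝ᵥ (M *ᵥ (α • u + β • v)) = α ^ 2 * a + β ^ 2 * b := by
    simp only [mulVec_add, mulVec_smul, hu, hv, add_dotProduct, dotProduct_add, smul_dotProduct,
      dotProduct_smul, huu, hvv, huv, hvu, smul_eq_mul]
    ring
  have hbound := hr (α • u + β • v) (by
    simpa [Finset.sum_add_distrib, ← Finset.mul_sum] using hmean)
  rw [hnorm, hform] at hbound
  refine le_of_mul_le_mul_right (hbound.trans ?_) hpos
  nlinarith [mul_le_mul_of_nonneg_left ha (sq_nonneg α),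
    mul_le_mul_of_nonneg_left hb (sq_nonneg β)]

theorem le_spectralGap {Q : Matrix Ω Ω ℝ} (hQ : Q.IsSymm) {r : ℝ} (hcard : 2 ≤ Fintype.card Ω)
    (hr : ∀ g : Ω → ℝ, ∑ x, g x = 0 → r * (g ⬝ᵥ g) ≤ g ⬝ᵥ ((-Q) *ᵥ g)) :
    r ≤ spectralGap Q := by
  classical
  have hA : (-Q).IsHermitian := by
    rw [Matrix.IsHermitian, Matrix.conjTranspose_eq_transpose_of_trivial, Matrix.transpose_neg, hQ]
  have hroots : (-Q).charpoly.roots = Finset.univ.val.map hA.eigenvalues := by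
    simpa using hA.roots_charpoly_eq_eigenvalues
  have hdot (k l : Ω) : (hA.eigenvectorBasis k : Ω → ℝ) ⬝ᵥ ⇑(hA.eigenvectorBasis l) =
      if k = l then 1 else 0 := by
    rw [← orthonormal_iff_ite.1 hA.eigenvectorBasis.orthonormal k l,
      EuclideanSpace.inner_eq_star_dotProduct, dotProduct_comm, star_trivial]
  obtain ⟨i, j, hij, hi, hj⟩ := exists_ne_le_sort_getD_one hA.eigenvalues 0 hcard
  rw [← hroots] at hi hj
  rw [spectralGap]
  exact le_of_orthonormal_eigenvectors ((hdot i i).trans (if_pos rfl))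
    ((hdot j j).trans (if_pos rfl)) ((hdot i j).trans (if_neg hij)) (hA.mulVec_eigenvectorBasis i)
    (hA.mulVec_eigenvectorBasis j) (by convert hi) (by convert hj) hr

theorem sum_mul_sq_sub_eq_dotProduct_neg_mulVec {Q : Matrix Ω Ω ℝ} (hQ : Q.IsSymm)
    (hrow : ∀ x, ∑ y, Q x y = 0) (g : Ω → ℝ) :
    ∑ x, ∑ y, Q x y * (g x - g y) ^ 2 = 2 * (g ⬝ᵥ ((-Q) *ᵥ g)) := by
  have hcol (y : Ω) : ∑ x, Q x y = 0 :=
    (Finset.sum_congr rfl fun x _ => hQ.apply y x).trans (hrow y)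
  have hleft : ∑ x, ∑ y, Q x y * g x ^ 2 = 0 := by
    simp only [← Finset.sum_mul, hrow, zero_mul, Finset.sum_const_zero]
  have hright : ∑ x, ∑ y, Q x y * g y ^ 2 = 0 := by
    rw [Finset.sum_comm]
    simp only [← Finset.sum_mul, hcol, zero_mul, Finset.sum_const_zero]
  have hcross : g ⬝ᵥ ((-Q) *ᵥ g) = -∑ x, ∑ y, g x * (Q x y * g y) := by
    simp [dotProduct, mulVec, Finset.mul_sum]
  calc _ = ∑ x, ∑ y, Q x y * g x ^ 2 + ∑ x, ∑ y, Q x y * g y ^ 2 -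
        2 * ∑ x, ∑ y, g x * (Q x y * g y) := by
        simp only [Finset.mul_sum, ← Finset.sum_add_distrib, ← Finset.sum_sub_distrib]
        exact Finset.sum_congr rfl fun x _ => Finset.sum_congr rfl fun y _ => by ring
    _ = _ := by
        rw [hleft, hright, hcross]
        ring

theorem sqDiffSum_univ_of_sum_eq_zero {g : Ω → ℝ} (hg : ∑ x, g x = 0) :
    sqDiffSum Finset.univ Finset.univ g = 2 * (Fintype.card Ω * (g ⬝ᵥ g)) := by
  have hexpand (x y : Ω) : (g x - g y) ^ 2 = g x * g x + g y * g y - 2 * (g x * g y) := by ring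
  simp only [sqDiffSum, hexpand, Finset.sum_sub_distrib, Finset.sum_add_distrib, ← Finset.mul_sum,
    hg, Finset.sum_const, Finset.card_univ, nsmul_eq_mul, mul_zero, dotProduct]
  simp only [mul_left_comm (g _), ← Finset.mul_sum]
  ring

/-- The indicator of the states that can be reached from `x` has nonpositive energy. -/
theorem isErgodicGenerator_of_poincare {Q : Matrix Ω Ω ℝ} (hQ : Q.IsSymm) {K : ℝ} (hK : 0 ≤ K)
    (hpoincare : ∀ f : Ω → ℝ, sqDiffSum Finset.univ Finset.univ f ≤
      K * ∑ x, ∑ y, Q x y * (f x - f y) ^ 2) : IsErgodicGenerator Q := by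
  classical
  intro x y
  by_contra hxy
  set R : Ω → Prop := Relation.ReflTransGen (fun a b => a ≠ b ∧ 0 < Q a b) x
  set f : Ω → ℝ := fun z => if R z then 1 else 0 with hf
  have hleave (a b : Ω) (ha : R a) (hb : ¬R b) : Q a b ≤ 0 := by
    by_contra! hpos
    exact hb (ha.tail ⟨fun hab => hb (hab ▸ ha), hpos⟩)
  have henergy : ∑ a, ∑ b, Q a b * (f a - f b) ^ 2 ≤ 0 := by
    refine Finset.sum_nonpos fun a _ => Finset.sum_nonpos fun b _ => ?_
    by_cases ha : R a <;> by_cases hb : R b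
    · simp [hf, ha, hb]
    · simpa [hf, ha, hb] using hleave a b ha hb
    · simpa [hf, ha, hb, hQ.apply] using hleave b a hb ha
    · simp [hf, ha, hb]
  have hconst : sqDiffSum {x} {y} f ≤ 0 :=
    calc sqDiffSum {x} {y} f ≤ sqDiffSum Finset.univ Finset.univ f :=
          (Finset.sum_le_sum fun _ _ => Finset.sum_le_sum_of_subset_of_nonneg
            (Finset.subset_univ _) fun _ _ _ => sq_nonneg _).trans <|
          Finset.sum_le_sum_of_subset_of_nonneg (Finset.subset_univ _)
            fun _ _ _ => Finset.sum_nonneg fun _ _ => sq_nonneg _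
      _ ≤ 0 := (hpoincare f).trans (mul_nonpos_of_nonneg_of_nonpos hK henergy)
  have hx : f x = 1 := if_pos Relation.ReflTransGen.refl
  have hy : f y = 0 := if_neg hxy
  norm_num [sqDiffSum, hx, hy] at hconst

theorem inv_le_spectralGap_of_poincare {Q : Matrix Ω Ω ℝ} (hQ : Q.IsSymm)
    (hrow : ∀ x, ∑ y, Q x y = 0) (hcard : 2 ≤ Fintype.card Ω) {K : ℝ} (hK : 0 < K)
    (hpoincare : ∀ f : Ω → ℝ, sqDiffSum Finset.univ Finset.univ f ≤
      K * Fintype.card Ω * ∑ x, ∑ y, Q x y * (f x - f y) ^ 2) : K⁻¹ ≤ spectralGap Q := by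
  refine le_spectralGap hQ hcard fun g hg => ?_
  have hN : (0 : ℝ) < Fintype.card Ω := by exact_mod_cast two_pos.trans_le hcard
  have hle := hpoincare g
  rw [sum_mul_sq_sub_eq_dotProduct_neg_mulVec hQ hrow, sqDiffSum_univ_of_sum_eq_zero hg] at hle
  rw [inv_mul_le_iff₀ hK]
  refine le_of_mul_le_mul_left ?_ hN
  linarith

theorem isErgodic_and_relaxationTime_le_of_poincare {Q : Matrix Ω Ω ℝ} (hQ : Q.IsSymm)
    (hrow : ∀ x, ∑ y, Q x y = 0) (hcard : 2 ≤ Fintype.card Ω) {K : ℝ} (hK : 0 < K)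
    (hpoincare : ∀ f : Ω → ℝ, sqDiffSum Finset.univ Finset.univ f ≤
      K * Fintype.card Ω * ∑ x, ∑ y, Q x y * (f x - f y) ^ 2) :
    IsErgodicGenerator Q ∧ 0 < spectralGap Q ∧ relaxationTime Q ≤ K := by
  have hgap := inv_le_spectralGap_of_poincare hQ hrow hcard hK hpoincare
  refine ⟨isErgodicGenerator_of_poincare hQ (by positivity) hpoincare,
    (inv_pos.2 hK).trans_le hgap, ?_⟩
  rw [relaxationTime, one_div]
  exact inv_le_of_inv_le₀ hK hgap

end SpectralGap

section Generator

variable {V : Type*} [Fintype V] {k : ℕ}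

theorem glauberRate_comm (p : V → ℝ) (σ η : V → Fin k) : glauberRate p σ η = glauberRate p η σ := by
  unfold glauberRate
  refine Finset.sum_congr rfl fun v _ => ?_
  congr 1
  simp only [DifferOnlyAt, ne_comm, eq_comm]

theorem glauberGenerator_isSymm (G : SimpleGraph V) (L : V → Finset (Fin k)) (p : V → ℝ) :
    (glauberGenerator G L p).IsSymm := by
  refine Matrix.IsSymm.ext fun σ η => ?_
  by_cases h : σ = η
  · rw [h]
  · simp [glauberGenerator, h, Ne.symm h, glauberRate_comm p η.1]

theorem sum_glauberGenerator (G : SimpleGraph V) (L : V → Finset (Fin k)) (p : V → ℝ)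
    (σ : ListColouring G L) : ∑ η, glauberGenerator G L p σ η = 0 := by
  classical
  rw [← Finset.add_sum_erase _ _ (Finset.mem_univ σ),
    Finset.sum_congr rfl fun η hη => show glauberGenerator G L p σ η = glauberRate p σ.1 η.1 by
      simp [glauberGenerator, (Finset.ne_of_mem_erase hη).symm]]
  simp only [glauberGenerator, Matrix.of_apply, if_true]
  rw [neg_add_eq_zero]

open Classical in
theorem sum_glauberGenerator_mul_sq (G : SimpleGraph V) (L : V → Finset (Fin k)) (p : V → ℝ)
    (f : ListColouring G L → ℝ) :
    ∑ σ, ∑ η, glauberGenerator G L p σ η * (f σ - f η) ^ 2 =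
      ∑ v, p v * ∑ σ, ∑ η, if DifferOnlyAt σ.1 η.1 v then (f σ - f η) ^ 2 else 0 := by
  have hterm (σ η : ListColouring G L) : glauberGenerator G L p σ η * (f σ - f η) ^ 2 =
      ∑ v, p v * if DifferOnlyAt σ.1 η.1 v then (f σ - f η) ^ 2 else 0 := by
    by_cases hση : σ = η
    · simp [hση]
    · simp [glauberGenerator, hση, glauberRate, Finset.sum_mul]
  simp_rw [hterm, Finset.mul_sum]
  rw [Finset.sum_comm (s := Finset.univ (α := V))]
  exact Finset.sum_congr rfl fun σ _ => Finset.sum_comm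

end Generator

section Clique

variable {V : Type*} {k : ℕ}

theorem injective_of_listColouring {L : V → Finset (Fin k)}
    (x : ListColouring (⊤ : SimpleGraph V) L) : Function.Injective x.1 := fun u v huv =>
  by_contra fun hne => x.2.1 u v hne huv

theorem eq_of_comp_some_eq {κ : Type*} {σ τ : Option V ≃ κ} (h : σ ∘ some = τ ∘ some) : σ = τ := by
  have hsome (v : V) : σ (some v) = τ (some v) := congrFun h v
  ext1 (- | v)
  · obtain ⟨o, ho⟩ := τ.surjective (σ none)
    obtain - | v := o
    · exact ho.symm
    · exact absurd (σ.injective ((hsome v).trans ho)) (Option.some_ne_none v)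
  · exact hsome v

theorem differOnlyAt_swap_comp_some [DecidableEq V] (σ : Option V ≃ Fin k) (v : V) :
    DifferOnlyAt (σ ∘ some) ((swap (some v) none).trans σ ∘ some) v := by
  refine ⟨fun h => ?_, fun u hu => ?_⟩
  · rw [Function.comp_apply, Function.comp_apply, Equiv.trans_apply, swap_apply_left] at h
    exact Option.some_ne_none v (σ.injective h)
  · rw [Function.comp_apply, Function.comp_apply, Equiv.trans_apply,
      swap_apply_of_ne_of_ne (by simpa using hu) (Option.some_ne_none u)]

variable [Fintype V]

theorem exists_equiv_comp_some_eq (hk : Fintype.card V + 1 = k) {x : V → Fin k}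
    (hx : Function.Injective x) : ∃ σ : Option V ≃ Fin k, σ ∘ some = x := by
  classical
  obtain ⟨c, -, hc⟩ : ∃ c ∈ Finset.univ, c ∉ Finset.univ.image x :=
    Finset.exists_mem_notMem_of_card_lt_card <|
      Finset.card_image_le.trans_lt (by simp [← hk])
  have hinj : Function.Injective (fun o : Option V => o.elim c x) := by
    rintro (- | u) (- | v) huv
    · rfl
    · exact absurd (Finset.mem_image.2 ⟨v, Finset.mem_univ v, huv.symm⟩) hc
    · exact absurd (Finset.mem_image.2 ⟨u, Finset.mem_univ u, huv⟩) hc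
    · exact congrArg some (hx huv)
  refine ⟨Equiv.ofBijective _ <| (Fintype.bijective_iff_injective_and_card _).2 ⟨hinj, ?_⟩, rfl⟩
  rw [Fintype.card_option, Fintype.card_fin, hk]

theorem exists_eq_univ [Nonempty V] (hk : Fintype.card V + 1 = k) {L : V → Finset (Fin k)}
    {S : Finset V} (hS : ∀ v ∈ S, S.card < (L v).card) (hfree : ∀ v ∉ S, L v = Finset.univ) :
    ∃ v, L v = Finset.univ := by
  obtain rfl | hne := eq_or_ne S Finset.univ
  · obtain ⟨v⟩ := ‹Nonempty V›
    refine ⟨v, Finset.eq_univ_of_card _ (le_antisymm (Finset.card_le_univ _) ?_)⟩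
    exact (Fintype.card_fin k).trans_le (hk.symm.trans_le (hS v (Finset.mem_univ v)))
  · obtain ⟨v, hv⟩ : ∃ v, v ∉ S := by simpa [Finset.eq_univ_iff_forall] using hne
    exact ⟨v, hfree v hv⟩

/-- The lists of the clique together with a hole `none`, which accepts every colour. If there is one
colour more than vertices, then the hole receives the colour that a colouring leaves out, and
colourings become bijections. -/
def cliqueLists (L : V → Finset (Fin k)) (o : Option V) : Finset (Fin k) :=
  o.elim Finset.univ L

variable [DecidableEq V] {L : V → Finset (Fin k)}

theorem comp_some_mem_listColouring {σ : Option V ≃ Fin k}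
    (hσ : σ ∈ listBijections (cliqueLists L)) :
    (∀ u v, (⊤ : SimpleGraph V).Adj u v → (σ ∘ some) u ≠ (σ ∘ some) v) ∧
      ∀ v, (σ ∘ some) v ∈ L v :=
  ⟨fun _ _ huv h => huv (Option.some_injective _ (σ.injective h)),
    fun v => mem_listBijections.1 hσ (some v)⟩

theorem sum_listBijections_cliqueLists (hk : Fintype.card V + 1 = k) (G : (V → Fin k) → ℝ) :
    ∑ σ ∈ listBijections (cliqueLists L), G (σ ∘ some) =
      ∑ x : ListColouring (⊤ : SimpleGraph V) L, G x.1 := by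
  refine Finset.sum_bij (fun σ hσ => ⟨σ ∘ some, comp_some_mem_listColouring hσ⟩)
    (fun _ _ => Finset.mem_univ _)
    (fun σ _ τ _ hστ => eq_of_comp_some_eq (congrArg Subtype.val hστ)) (fun x _ => ?_)
    fun _ _ => rfl
  obtain ⟨σ, hσ⟩ := exists_equiv_comp_some_eq hk (injective_of_listColouring x)
  refine ⟨σ, mem_listBijections.2 ?_, Subtype.ext hσ⟩
  rintro (- | v)
  · exact Finset.mem_univ _
  · exact Eq.subst (motive := (· ∈ L v)) (congrFun hσ v).symm (x.2.2 v)

theorem card_listBijections_cliqueLists (hk : Fintype.card V + 1 = k) :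
    (listBijections (cliqueLists L)).card =
      Fintype.card (ListColouring (⊤ : SimpleGraph V) L) := by
  have h := sum_listBijections_cliqueLists (L := L) hk fun _ => 1
  simpa using h

theorem sqDiffSum_listBijections_cliqueLists (hk : Fintype.card V + 1 = k) (G : (V → Fin k) → ℝ) :
    sqDiffSum (listBijections (cliqueLists L)) (listBijections (cliqueLists L))
        (fun σ => G (σ ∘ some)) =
      sqDiffSum Finset.univ Finset.univ fun x : ListColouring (⊤ : SimpleGraph V) L => G x.1 := by
  rw [sqDiffSum, sqDiffSum, ← sum_listBijections_cliqueLists hk fun x =>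
    ∑ y : ListColouring (⊤ : SimpleGraph V) L, (G x - G y.1) ^ 2]
  exact Finset.sum_congr rfl fun σ _ =>
    sum_listBijections_cliqueLists hk fun y => (G (σ ∘ some) - G y) ^ 2

open Classical in
theorem dirichletForm_comp_some_le (hk : Fintype.card V + 1 = k) (G : (V → Fin k) → ℝ) (v : V) :
    dirichletForm (listBijections (cliqueLists L)) (fun σ => G (σ ∘ some)) (swap (some v) none) ≤
      ∑ x : ListColouring (⊤ : SimpleGraph V) L, ∑ y : ListColouring (⊤ : SimpleGraph V) L,
        if DifferOnlyAt x.1 y.1 v then (G x.1 - G y.1) ^ 2 else 0 := by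
  have hnonneg (x : V → Fin k) (y : ListColouring (⊤ : SimpleGraph V) L) :
      0 ≤ if DifferOnlyAt x y.1 v then (G x - G y.1) ^ 2 else 0 := by
    split_ifs <;> positivity
  rw [← sum_listBijections_cliqueLists hk fun x =>
    ∑ y : ListColouring (⊤ : SimpleGraph V) L,
      if DifferOnlyAt x y.1 v then (G x - G y.1) ^ 2 else 0]
  refine (Finset.sum_le_sum fun σ hσ => ?_).trans (Finset.sum_le_sum_of_subset_of_nonneg
    (Finset.filter_subset _ _) fun σ _ _ => Finset.sum_nonneg fun y _ => hnonneg _ y)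
  have hle := Finset.single_le_sum (fun y _ => hnonneg (σ ∘ some) y) (Finset.mem_univ
    ⟨_, comp_some_mem_listColouring (Finset.mem_filter.1 hσ).2⟩)
  rwa [if_pos (differOnlyAt_swap_comp_some σ v)] at hle

variable {S : Finset V}

theorem isConstrained_cliqueLists (hS : ∀ v ∈ S, S.card < (L v).card)
    (hfree : ∀ v ∉ S, L v = Finset.univ) :
    IsConstrained (cliqueLists L) (S.map .some) (Finset.insertNone Sᶜ) none where
  hole_mem := Finset.none_mem_insertNone
  disjoint := by
    rw [Finset.disjoint_left]
    intro o ho ho'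
    obtain ⟨v, hv, rfl⟩ := Finset.mem_map.1 ho
    exact Finset.mem_compl.1 (Finset.some_mem_insertNone.1 ho') hv
  free := Finset.forall_mem_insertNone.2 ⟨rfl, fun v hv => hfree v (Finset.mem_compl.1 hv)⟩
  subset _ _ := Finset.subset_univ _
  card_lt := by simpa [cliqueLists] using hS
  frozen := by
    rintro (- | v) hoS hoF
    · exact absurd Finset.none_mem_insertNone hoF
    · simp_all

theorem exists_mem_listBijections_cliqueLists (hk : Fintype.card V + 1 = k)
    (hS : ∀ v ∈ S, S.card < (L v).card) (hfree : ∀ v ∉ S, L v = Finset.univ) :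
    (listBijections (cliqueLists L)).Nonempty := by
  have hall (T : Finset (Option V)) : T.card ≤ (T.biUnion (cliqueLists L)).card := by
    by_cases hT : T ⊆ S.map .some
    · obtain rfl | ⟨o, ho⟩ := T.eq_empty_or_nonempty
      · exact Nat.zero_le _
      obtain ⟨v, hv, rfl⟩ := Finset.mem_map.1 (hT ho)
      calc T.card ≤ S.card := (Finset.card_le_card hT).trans_eq (Finset.card_map _)
        _ ≤ (L v).card := (hS v hv).le
        _ ≤ _ := Finset.card_le_card (Finset.subset_biUnion_of_mem (cliqueLists L) ho)
    · obtain ⟨o, ho, hoS⟩ := Finset.not_subset.1 hT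
      have huniv : cliqueLists L o = Finset.univ := by
        obtain - | v := o
        · rfl
        · exact hfree v fun hv => hoS (Finset.mem_map_of_mem _ hv)
      calc T.card ≤ (cliqueLists L o).card := by
            rw [huniv, Finset.card_univ, Fintype.card_fin, ← hk, ← Fintype.card_option]
            exact Finset.card_le_univ T
        _ ≤ _ := Finset.card_le_card (Finset.subset_biUnion_of_mem (cliqueLists L) ho)
  obtain ⟨σ, hinj, hσ⟩ := (Finset.all_card_le_biUnion_card_iff_exists_injective _).1 hall
  exact ⟨Equiv.ofBijective σ <| (Fintype.bijective_iff_injective_and_card σ).2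
    ⟨hinj, by rw [Fintype.card_option, Fintype.card_fin, hk]⟩, mem_listBijections.2 hσ⟩

theorem rateCost_insertNone_le (S : Finset V) {p : Option V → ℝ} (hp : ∀ v, 0 < p (some v)) :
    rateCost p (S.map .some) (Finset.insertNone Sᶜ) none ≤
      ∑ v ∈ S, Fintype.card V / p (some v) + ∑ v ∈ Sᶜ, 1 / p (some v) := by
  have herase : (Finset.insertNone Sᶜ).erase none = Sᶜ.map .some := by
    rw [← Finset.map_some_eraseNone, Finset.eraseNone_insertNone]
  rw [rateCost, herase, Finset.sum_map, Finset.sum_map, Finset.card_insertNone]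
  refine add_le_add_left (Finset.sum_le_sum fun v hv => ?_) _
  refine div_le_div_of_nonneg_right (Nat.cast_le.2 ?_) (hp v).le
  have := Finset.card_pos.2 ⟨v, hv⟩
  have := Finset.card_add_card_compl S
  omega

open Classical in
theorem holeEnergy_cliqueLists_le (hk : Fintype.card V + 1 = k) {p : Option V → ℝ}
    (hp : ∀ v, 0 < p (some v)) (G : (V → Fin k) → ℝ) :
    holeEnergy p (listBijections (cliqueLists L)) none (fun σ => G (σ ∘ some)) ≤
      ∑ x : ListColouring (⊤ : SimpleGraph V) L, ∑ y : ListColouring (⊤ : SimpleGraph V) L,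
        glauberGenerator ⊤ L (p ∘ some) x y * (G x.1 - G y.1) ^ 2 := by
  rw [sum_glauberGenerator_mul_sq ⊤ L (p ∘ some) fun x => G x.1, holeEnergy, Fintype.sum_option,
    swap_self, ← Perm.one_def, dirichletForm_one, mul_zero, zero_add]
  exact Finset.sum_le_sum fun v _ =>
    mul_le_mul_of_nonneg_left (dirichletForm_comp_some_le hk G v) (hp v).le

theorem sqDiffSum_listColouring_le (hk : Fintype.card V + 1 = k)
    (hS : ∀ v ∈ S, S.card < (L v).card) (hfree : ∀ v ∉ S, L v = Finset.univ) {p : V → ℝ}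
    (hp : ∀ v, 0 < p v) (f : ListColouring (⊤ : SimpleGraph V) L → ℝ) :
    sqDiffSum Finset.univ Finset.univ f ≤
      poincareConst S.card * (∑ v ∈ S, Fintype.card V / p v + ∑ v ∈ Sᶜ, 1 / p v) *
        Fintype.card (ListColouring (⊤ : SimpleGraph V) L) *
        ∑ x, ∑ y, glauberGenerator ⊤ L p x y * (f x - f y) ^ 2 := by
  obtain ⟨G, rfl⟩ : ∃ G : (V → Fin k) → ℝ, (fun x => G x.1) = f :=
    ⟨Function.extend Subtype.val f 0, funext (Subtype.val_injective.extend_apply f 0)⟩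
  set q : Option V → ℝ := fun o => o.elim 1 p
  have hq (o : Option V) : 0 < q o := o.rec one_pos hp
  set X := listBijections (cliqueLists L)
  rw [← sqDiffSum_listBijections_cliqueLists hk, ← card_listBijections_cliqueLists hk]
  calc _ ≤ poincareConst (S.map .some).card * X.card *
          (rateCost q (S.map .some) (Finset.insertNone Sᶜ) none *
            holeEnergy q X none fun σ => G (σ ∘ some)) :=
        (isConstrained_cliqueLists hS hfree).sqDiffSum_le hq _
    _ ≤ poincareConst S.card * X.card *
          ((∑ v ∈ S, Fintype.card V / p v + ∑ v ∈ Sᶜ, 1 / p v) *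
            ∑ x, ∑ y, glauberGenerator ⊤ L p x y * (G x.1 - G y.1) ^ 2) := by
        rw [Finset.card_map]
        have hconst := (poincareConst_pos S.card).le
        have hcost := rateCost_nonneg hq (S.map .some) (Finset.insertNone Sᶜ) none
        have hle := rateCost_insertNone_le S fun v => hq (some v)
        refine mul_le_mul_of_nonneg_left (mul_le_mul hle
          (holeEnergy_cliqueLists_le hk (fun v => hq (some v)) G)
          (holeEnergy_nonneg hq X none _) (hcost.trans hle)) (by positivity)
    _ = _ := by ring

end Clique

theorem two_le_card_listColouring {V : Type*} [Fintype V] [Nonempty V] {k : ℕ}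
    (hk : Fintype.card V + 1 = k) {L : V → Finset (Fin k)} {S : Finset V}
    (hS : ∀ v ∈ S, S.card < (L v).card) (hfree : ∀ v ∉ S, L v = Finset.univ) :
    2 ≤ Fintype.card (ListColouring (⊤ : SimpleGraph V) L) := by
  classical
  obtain ⟨σ, hσ⟩ := exists_mem_listBijections_cliqueLists hk hS hfree
  obtain ⟨v, hv⟩ := exists_eq_univ hk hS hfree
  have hswap : (swap (some v) none).trans σ ∈ listBijections (cliqueLists L) := by
    refine (trans_mem_listBijections_iff (fun o => ?_) σ).2 hσ
    rw [swap_apply_def]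
    split_ifs with hsome hnone
    · rw [hsome]
      exact hv.symm
    · rw [hnone]
      exact hv
    · rfl
  refine Fintype.one_lt_card_iff.2 ⟨⟨_, comp_some_mem_listColouring hσ⟩,
    ⟨_, comp_some_mem_listColouring hswap⟩, fun h => ?_⟩
  exact (differOnlyAt_swap_comp_some σ v).1 (congrFun (congrArg Subtype.val h) v)

theorem mainTheorem2_general {V : Type*} [Fintype V] [DecidableEq V] [Nonempty V] {k : ℕ}
    (hk : Fintype.card V + 1 = k) {L : V → Finset (Fin k)} {S : Finset V}
    (hS : ∀ v ∈ S, S.card < (L v).card) (hfree : ∀ v ∉ S, L v = Finset.univ) {p : V → ℝ}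
    (hp : ∀ v, 0 < p v) :
    IsErgodicGenerator (glauberGenerator (⊤ : SimpleGraph V) L p) ∧
      0 < spectralGap (glauberGenerator (⊤ : SimpleGraph V) L p) ∧
      relaxationTime (glauberGenerator (⊤ : SimpleGraph V) L p) ≤
        poincareConst S.card * (∑ v ∈ S, Fintype.card V / p v + ∑ v ∈ Sᶜ, 1 / p v) := by
  refine isErgodic_and_relaxationTime_le_of_poincare (glauberGenerator_isSymm _ _ _)
    (sum_glauberGenerator _ _ _) (two_le_card_listColouring hk hS hfree)
    (mul_pos (poincareConst_pos _) ?_) (sqDiffSum_listColouring_le hk hS hfree hp)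
  have hV : (0 : ℝ) < Fintype.card V := Nat.cast_pos.2 Fintype.card_pos
  obtain rfl | hne := S.eq_empty_or_nonempty
  · simpa using Finset.sum_pos (fun v _ => inv_pos.2 (hp v)) Finset.univ_nonempty
  · exact add_pos_of_pos_of_nonneg (Finset.sum_pos (fun v _ => div_pos hV (hp v)) hne)
      (Finset.sum_nonneg fun v _ => one_div_nonneg.2 (hp v).le)

theorem IsFeasible.le {d t : ℕ} {L : Fin d → Finset (Fin (d + 1))} (hL : IsFeasible t L)
    (hd : 1 ≤ d) : t ≤ d := by
  by_contra! htd
  have hle := hL.constrained ⟨0, hd⟩ (Nat.zero_lt_of_lt htd)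
  have hcard := Finset.card_le_univ (L ⟨0, hd⟩)
  rw [Fintype.card_fin] at hcard
  omega

theorem mainTheorem2 (t : ℕ) (ht : 1 ≤ t) :
    ∃ C : ℝ, 0 < C ∧
      ∀ (d : ℕ), 1 ≤ d →
      ∀ (L : Fin d → Finset (Fin (d + 1))), IsFeasible t L →
      ∀ (p : Fin d → ℝ), (∀ i, 0 < p i) →
        IsErgodicGenerator (glauberGenerator (⊤ : SimpleGraph (Fin d)) L p) ∧
        0 < spectralGap (glauberGenerator (⊤ : SimpleGraph (Fin d)) L p) ∧
        relaxationTime (glauberGenerator (⊤ : SimpleGraph (Fin d)) L p) ≤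
          C * ((∑ i : Fin d with i.val < t, (d : ℝ) / p i) +
            (∑ i : Fin d with t ≤ i.val, 1 / p i)) := by
  refine ⟨poincareConst t, poincareConst_pos t, fun d hd L hL p hp => ?_⟩
  have : Nonempty (Fin d) := ⟨⟨0, hd⟩⟩
  have hcard : Finset.card {i : Fin d | i.val < t} = t := by
    rw [Fin.card_filter_val_lt, min_eq_right (hL.le hd)]
  have h := mainTheorem2_general (S := {i : Fin d | i.val < t}) (by rw [Fintype.card_fin])
    (fun i hi => hcard.trans_lt (hL.constrained i (Finset.mem_filter.1 hi).2))
    (fun i hi => Finset.eq_univ_of_card _ <| (hL.free i (by simpa using hi)).trans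
      (Fintype.card_fin _).symm) hp
  simpa only [hcard, Fintype.card_fin, Finset.compl_filter, not_lt] using h
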